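/- Let $f:\mathbb{R}\to\mathbb{C}$ be a bounded continuous function with $f(0)=1$ and $$\int_{-\infty}^{\infty}\frac{|f(t)|}{1+|t|}\,dt<\infty ,$$ and let $$k_f(z)=\frac{i}{\pi}\int_{-\infty}^{\infty}\frac{f(t)}{z-t}\,dt,\qquad z\in\mathbb{C}\setminus\mathbb{R},$$ be its Cauchy transform. Then $f$ is a characteristic function, i.e. there is a probability measure $\sigma$ on $\mathbb{R}$ with $f(x)=\int_{-\infty}^{\infty}e^{ixt}\,d\sigma(t)$ for all $x\in\mathbb{R}$, if and only if both of the following conditions hold: (i) the function $y\mapsto k_f(iy)$ is real-valued and completely monotonic on $(0,\infty)$; (ii) the function $y\mapsto -k_f(iy)$ is real-valued and absolutely monotonic on $(-\infty,0)$. Here a function $\omega:(a,b)\to\mathbb{R}$, $-\infty\le a<b\le\infty$, is completely monotonic on $(a,b)$ if it is infinitely differentiable and $(-1)^n\omega^{(n)}(x)\ge 0$ for all $x\in(a,b)$ and all $n=0,1,2,\dots$; it is absolutely monotonic on $(a,b)$ if $x\mapsto\omega(-x)$ is completely monotonic on $(-b,-a)$, that is, if $\omega$ is infinitely differentiable and $\omega^{(n)}(x)\ge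 0$ for all $x\in(a,b)$ and all $n=0,1,2,\dots$. -/

import Mathlib

open MeasureTheory Set
open scoped ContDiff

/-- The Cauchy transform `k_f(z) = (i/π) ∫ f(t)/(z - t) dt` (used for `z ∉ ℝ`). -/
noncomputable def cauchyTransform (f : ℝ → ℂ) (z : ℂ) : ℂ :=
  (Complex.I / (Real.pi : ℂ)) * ∫ t : ℝ, f t / (z - (t : ℂ))

/-- `f` is the characteristic function `x ↦ ∫ exp(i x t) dσ(t)` of some probability measure `σ`
on the real line. -/
def IsCharacteristicFunction (f : ℝ → ℂ) : Prop :=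
  ∃ σ : Measure ℝ, IsProbabilityMeasure σ ∧ ∀ x : ℝ, f x = charFun σ x

/-- `g` is completely monotonic on the open set (in practice, open interval) `s`: it is infinitely
differentiable there and `(-1)^n g^(n) ≥ 0` on `s` for every `n`. -/
def CompletelyMonotonicOn (g : ℝ → ℝ) (s : Set ℝ) : Prop :=
  ContDiffOn ℝ ∞ g s ∧ ∀ n : ℕ, ∀ x ∈ s, 0 ≤ (-1 : ℝ) ^ n * iteratedDerivWithin n g s x

/-! Necessity. If `f` is the characteristic function of `σ`, Fubini and Fourier inversion give
`k_f(iy) - k_f(iY) = 2 ∫_{s>0} (e^{-ys} - e^{-Ys}) dσ(s)` for `y, Y > 0`. Since `k_f(iY) → 0` as `Y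
→ ∞`, `k_f(iy)` is a Laplace transform of twice `σ` on the open half-line
(`cauchyTransform_charFun_I_mul`), hence completely monotonic. Reflecting `σ` handles `y < 0`.

Sufficiency. `F(w) = k_f(iw)` is holomorphic on `Re w > 0`. Complete monotonicity says that its
Taylor coefficients at a positive centre have signs `(-1)^k`. On the circle with centre `δ + N` and
radius `N`, the Taylor series is therefore a sum of exponentials with nonnegative weights, that is,
a characteristic function. As `N → ∞` these circles flatten to the line `Re w = δ`, so `x ↦ k_f(x +
iδ)` is a limit of characteristic functions; likewise `-k_f(x - iδ)`. Their sum is twice the Poisson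
integral of `f`, which tends to `2f` as `δ → 0`. Lévy's continuity theorem
(`exists_charFun_eq_of_tendsto`), applied to both limits, yields the measure. Bernstein's theorem is
not needed. -/

/-! ### Cauchy kernel bounds and holomorphy of the transform. -/

theorem one_add_abs_le_mul_norm_sub {z : ℂ} {η R : ℝ} (hη : 0 < η) (hz : η ≤ |z.im|)
    (hR : ‖z‖ ≤ R) (t : ℝ) : 1 + |t| ≤ ((1 + R) / η + 1) * ‖z - t‖ := by
  have h1 : η ≤ ‖z - t‖ := hz.trans (by simpa using Complex.abs_im_le_norm (z - t))
  have h2 : |t| ≤ ‖z‖ + ‖z - t‖ := by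
    have := norm_sub_le z (z - t)
    simpa using this
  have h3 : 0 ≤ 1 + R := by linarith [norm_nonneg z]
  have h4 : 1 + R ≤ (1 + R) / η * ‖z - t‖ := by
    rw [div_mul_eq_mul_div, le_div_iff₀ hη]
    exact mul_le_mul_of_nonneg_left h1 h3
  linarith

theorem inv_norm_sub_le {z : ℂ} {η R : ℝ} (hη : 0 < η) (hz : η ≤ |z.im|)
    (hR : ‖z‖ ≤ R) (t : ℝ) : ‖z - t‖⁻¹ ≤ ((1 + R) / η + 1) / (1 + |t|) := by
  have h1 : 0 < ‖z - t‖ :=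
    hη.trans_le (hz.trans (by simpa using Complex.abs_im_le_norm (z - t)))
  have h2 : 0 < 1 + |t| := by positivity
  rw [inv_le_iff_one_le_mul₀ h1, div_mul_eq_mul_div, one_le_div h2]
  exact one_add_abs_le_mul_norm_sub hη hz hR t

theorem sub_ofReal_ne_zero {z : ℂ} (hz : z.im ≠ 0) (t : ℝ) : z - t ≠ 0 := by
  intro h
  apply hz
  simpa using congrArg Complex.im h

theorem continuous_div_sub_ofReal {f : ℝ → ℂ} (hf : Continuous f) {z : ℂ} (hz : z.im ≠ 0) :
    Continuous fun t : ℝ => f t / (z - t) :=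
  hf.div (by fun_prop) (sub_ofReal_ne_zero hz)

theorem integrable_div_sub_ofReal {f : ℝ → ℂ} (hf : Continuous f)
    (hint : Integrable fun t : ℝ => ‖f t‖ / (1 + |t|)) {z : ℂ} (hz : z.im ≠ 0) :
    Integrable fun t : ℝ => f t / (z - t) := by
  refine (hint.const_mul ((1 + ‖z‖) / |z.im| + 1)).mono'
    (continuous_div_sub_ofReal hf hz).aestronglyMeasurable (.of_forall fun t => ?_)
  rw [norm_div, div_eq_mul_inv]
  refine (mul_le_mul_of_nonneg_left
    (inv_norm_sub_le (abs_pos.2 hz) le_rfl le_rfl t) (norm_nonneg _)).trans_eq ?_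
  ring

theorem differentiableAt_cauchyTransform {f : ℝ → ℂ} (hf : Continuous f)
    (hint : Integrable fun t : ℝ => ‖f t‖ / (1 + |t|)) {z : ℂ} (hz : z.im ≠ 0) :
    DifferentiableAt ℂ (cauchyTransform f) z := by
  have hη : 0 < |z.im| / 2 := by have := abs_pos.2 hz; linarith
  have him : ∀ w ∈ Metric.ball z (|z.im| / 2), |z.im| / 2 ≤ |w.im| := by
    intro w hw
    rw [Metric.mem_ball, dist_eq_norm] at hw
    have h1 := Complex.abs_im_le_norm (w - z)
    rw [Complex.sub_im] at h1
    have h2 := abs_sub_abs_le_abs_sub z.im w.im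
    rw [abs_sub_comm] at h2
    linarith
  have hne : ∀ w ∈ Metric.ball z (|z.im| / 2), w.im ≠ 0 := fun w hw =>
    abs_pos.1 (hη.trans_le (him w hw))
  have hnorm : ∀ w ∈ Metric.ball z (|z.im| / 2), ‖w‖ ≤ ‖z‖ + |z.im| / 2 := by
    intro w hw
    rw [Metric.mem_ball, dist_eq_norm] at hw
    have := norm_add_le z (w - z)
    rw [add_sub_cancel] at this
    linarith
  set C : ℝ := (1 + (‖z‖ + |z.im| / 2)) / (|z.im| / 2) + 1
  have hder := hasDerivAt_integral_of_dominated_loc_of_deriv_le (μ := volume)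
    (F := fun (w : ℂ) (t : ℝ) => f t / (w - t)) (F' := fun (w : ℂ) (t : ℝ) => -f t / (w - t) ^ 2)
    (x₀ := z) (s := Metric.ball z (|z.im| / 2))
    -- Of the two factors `‖w - t‖⁻¹` in the derivative, one is bounded by `C / (1 + |t|)`, the
    -- other by the inverse distance of the ball to the real line.
    (bound := fun t => C / (|z.im| / 2) * (‖f t‖ / (1 + |t|)))
    (Metric.ball_mem_nhds z hη)
    (by
      filter_upwards [Metric.ball_mem_nhds z hη] with w hw
      exact (continuous_div_sub_ofReal hf (hne w hw)).aestronglyMeasurable)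
    (integrable_div_sub_ofReal hf hint hz)
    (by
      refine Continuous.aestronglyMeasurable (hf.neg.div (by fun_prop) fun t => ?_)
      exact pow_ne_zero 2 (sub_ofReal_ne_zero hz t))
    (.of_forall fun t w hw => by
      rw [norm_div, norm_neg, norm_pow, div_eq_mul_inv, sq, mul_inv]
      have h1 := inv_norm_sub_le hη (him w hw) (hnorm w hw) t
      have h2 : ‖w - t‖⁻¹ ≤ (|z.im| / 2)⁻¹ :=
        inv_anti₀ hη ((him w hw).trans (by simpa using Complex.abs_im_le_norm (w - t)))
      calc ‖f t‖ * (‖w - t‖⁻¹ * ‖w - t‖⁻¹) ≤ ‖f t‖ * (C / (1 + |t|) * (|z.im| / 2)⁻¹) := by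
            gcongr
        _ = _ := by ring)
    (hint.const_mul _)
    (.of_forall fun t w hw => by
      have h := ((hasDerivAt_id w).sub_const (t : ℂ)).fun_inv (sub_ofReal_ne_zero (hne w hw) t)
      have h' := h.const_mul (f t)
      have h'' := h'.congr_deriv (g' := -f t / (w - t) ^ 2) (by simp only [id]; ring)
      simpa only [id, ← div_eq_mul_inv] using h'')
  exact (hder.2.const_mul _).differentiableAt

theorem cauchyTransform_comp_neg (f : ℝ → ℂ) (z : ℂ) :
    cauchyTransform (fun t => f (-t)) z = -cauchyTransform f (-z) := by
  rw [cauchyTransform, cauchyTransform, ← integral_neg_eq_self, ← mul_neg, ← integral_neg]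
  congr 2 with t
  rw [neg_neg, ← div_neg]
  congr 1
  push_cast
  ring

theorem integrable_norm_div_comp_neg {f : ℝ → ℂ}
    (hint : Integrable fun t : ℝ => ‖f t‖ / (1 + |t|)) :
    Integrable fun t : ℝ => ‖f (-t)‖ / (1 + |t|) := by
  simpa using hint.comp_neg

/-! ### Lévy continuity for finite measures. -/

open Filter Topology in
/-- A pointwise limit of characteristic functions of finite measures that is continuous at `0` is
the characteristic function of a finite measure. -/
theorem exists_charFun_eq_of_tendsto {μ : ℕ → Measure ℝ} [∀ n, IsFiniteMeasure (μ n)]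
    {φ : ℝ → ℂ} (hφ : ContinuousAt φ 0)
    (h : ∀ x, Tendsto (fun n => charFun (μ n) x) atTop (𝓝 (φ x))) :
    ∃ σ : Measure ℝ, IsFiniteMeasure σ ∧ ∀ x, charFun σ x = φ x := by
  have hmass : Tendsto (fun n => (μ n).real univ) atTop (𝓝 (φ 0).re) := by
    have h0 := (Complex.continuous_re.tendsto _).comp (h 0)
    simpa [Function.comp_def] using h0
  have hφ0 : φ 0 = ((φ 0).re : ℂ) := by
    have h0 := (Complex.continuous_ofReal.tendsto _).comp hmass
    have h1 := h 0
    simp only [charFun_zero] at h1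
    exact tendsto_nhds_unique h1 h0
  have hpos : 0 ≤ (φ 0).re := ge_of_tendsto' hmass fun n => measureReal_nonneg
  rcases hpos.eq_or_lt with hz | hp
  -- Masses tending to zero cannot be normalised, but then `‖φ x‖` is at most the limit mass, so `φ
  -- = 0`.
  · refine ⟨0, inferInstance, fun x => ?_⟩
    have : ‖φ x‖ ≤ (φ 0).re :=
      le_of_tendsto_of_tendsto' (h x).norm hmass fun n => norm_charFun_le x
    rw [← hz] at this
    simp [norm_le_zero_iff.1 this]
  obtain ⟨N, hN⟩ := eventually_atTop.1 (hmass.eventually (lt_mem_nhds hp))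
  have hne : ∀ n, μ (n + N) univ ≠ 0 := fun n h0 => by
    have := hN (n + N) (by omega)
    simp [Measure.real, h0] at this
  let ν : ℕ → ProbabilityMeasure ℝ := fun n =>
    ⟨(μ (n + N) univ)⁻¹ • μ (n + N), ⟨by
      simpa using ENNReal.inv_mul_cancel (hne n) (measure_ne_top _ _)⟩⟩
  have hν : ∀ x, Tendsto (fun n => charFun (ν n : Measure ℝ) x) atTop (𝓝 (φ x / φ 0)) := by
    intro x
    have h1 := ((h x).comp (tendsto_add_atTop_nat N)).div
      ((h 0).comp (tendsto_add_atTop_nat N)) (by rw [hφ0]; exact_mod_cast hp.ne')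
    refine h1.congr fun n => ?_
    simp only [ν, Pi.div_apply, Function.comp_apply, ProbabilityMeasure.coe_mk, charFun_zero]
    rw [charFun_apply, charFun_apply, integral_smul_measure, ENNReal.toReal_inv, Measure.real,
      div_eq_inv_mul, Complex.real_smul, Complex.ofReal_inv]
  have htight : IsTightMeasureSet {((ρ : ProbabilityMeasure ℝ) : Measure ℝ) | ρ ∈ range ν} := by
    have := isTightMeasureSet_of_tendsto_charFun (μ := fun n => (ν n : Measure ℝ))
      (hφ.div_const (φ 0)) hν
    convert this using 1
    ext ρ
    simp
  -- Tightness gives compactness of the closure; an ultrafilter finer than `atTop` replaces a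
  -- convergent subsequence.
  obtain ⟨U, hU⟩ := Ultrafilter.exists_le (atTop : Filter ℕ)
  obtain ⟨ρ, -, hρ⟩ := (isCompact_closure_of_isTightMeasureSet htight).ultrafilter_le_nhds
    (U.map ν) (by
      refine le_principal_iff.2 (mem_of_superset ?_ subset_closure)
      exact Ultrafilter.mem_map.2 (univ_mem' fun n => mem_range_self n))
  have hρ' : Tendsto ν U (𝓝 ρ) := hρ
  rw [ProbabilityMeasure.tendsto_iff_forall_integral_rclike_tendsto ℂ] at hρ'
  have hchar : ∀ x, charFun (ρ : Measure ℝ) x = φ x / φ 0 := by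
    intro x
    have h1 := hρ' (BoundedContinuousFunction.innerProbChar x)
    simp_rw [← charFun_eq_integral_innerProbChar] at h1
    exact tendsto_nhds_unique h1 ((hν x).mono_left hU)
  refine ⟨(φ 0).re.toNNReal • (ρ : Measure ℝ), inferInstance, fun x => ?_⟩
  have h2 := hchar x
  rw [charFun_apply] at h2 ⊢
  rw [integral_smul_nnreal_measure, h2, NNReal.smul_def, Real.coe_toNNReal _ hpos,
    Complex.real_smul, ← hφ0, mul_div_cancel₀]
  rw [hφ0]
  exact_mod_cast hp.ne'

/-! ### From complete monotonicity to limits of characteristic functions. -/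

/-- A sum of nonnegative weights times the exponentials `exp (i x s n)` is a characteristic
function. -/
theorem exists_charFun_eq_of_hasSum {a : ℕ → ℝ} (ha : ∀ n, 0 ≤ a n) (hs : Summable a)
    (p : ℕ → ℝ) :
    ∃ μ : Measure ℝ, IsFiniteMeasure μ ∧
      ∀ x : ℝ, HasSum (fun n => (a n : ℂ) * Complex.exp (x * p n * Complex.I)) (charFun μ x) := by
  let m : ℕ → Measure ℝ := fun n => (a n).toNNReal • Measure.dirac (p n)
  have hfin : IsFiniteMeasure (Measure.sum m) := by
    refine ⟨?_⟩
    rw [Measure.sum_apply _ MeasurableSet.univ]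
    simp only [m, Measure.smul_apply, measure_univ, ENNReal.smul_def,
      smul_eq_mul, mul_one]
    exact (ENNReal.tsum_coe_ne_top_iff_summable.2 hs.toNNReal).lt_top
  refine ⟨Measure.sum m, hfin, fun x => ?_⟩
  have hint : Integrable (fun s : ℝ => Complex.exp (inner ℝ s x * Complex.I)) (Measure.sum m) := by
    refine (integrable_const (1 : ℝ)).mono' (by fun_prop) (.of_forall fun s => ?_)
    rw [Complex.norm_exp_ofReal_mul_I]
  have key : ∀ n, ∫ s : ℝ, Complex.exp (inner ℝ s x * Complex.I) ∂m n =
      (a n : ℂ) * Complex.exp (x * p n * Complex.I) := by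
    intro n
    simp only [m]
    rw [integral_smul_nnreal_measure, integral_dirac, NNReal.smul_def,
      Real.coe_toNNReal _ (ha n), Complex.real_smul]
    simp
  simpa only [charFun_apply, key] using hasSum_integral_measure hint

theorem iteratedDeriv_ofReal_eq {F : ℂ → ℂ} {g : ℝ → ℝ}
    (hF : DifferentiableOn ℂ F {w | 0 < w.re}) (hg : ContDiffOn ℝ ∞ g (Ioi 0))
    (hFg : ∀ y : ℝ, 0 < y → F y = g y) (n : ℕ) {y : ℝ} (hy : 0 < y) :
    iteratedDeriv n F y = ((iteratedDerivWithin n g (Ioi 0) y : ℝ) : ℂ) := by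
  have hopen : IsOpen {w : ℂ | 0 < w.re} := isOpen_lt continuous_const Complex.continuous_re
  induction n generalizing y with
  | zero => simpa using hFg y hy
  | succ n ih =>
    have h1 : DifferentiableAt ℂ (iteratedDeriv n F) y := by
      have := (hF.analyticOnNhd hopen).iterated_deriv n y (by simpa using hy)
      rw [← iteratedDeriv_eq_iterate] at this
      exact this.differentiableAt
    have h2 : DifferentiableAt ℝ (iteratedDerivWithin n g (Ioi 0)) y :=
      ((hg.differentiableOn_iteratedDerivWithin (m := n) (mod_cast WithTop.coe_lt_top _)
        isOpen_Ioi.uniqueDiffOn) y hy).differentiableAt (Ioi_mem_nhds hy)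
    have h3 := h1.hasDerivAt.comp_ofReal
    have h4 := h2.hasDerivAt.ofReal_comp
    rw [iteratedDeriv_succ, iteratedDerivWithin_succ, derivWithin_of_mem_nhds (Ioi_mem_nhds hy)]
    refine h3.unique (h4.congr_of_eventuallyEq ?_)
    filter_upwards [Ioi_mem_nhds hy] with t ht using ih ht

-- The circles of radius `n + 1` tangent to a vertical line at a fixed point flatten to that line;
-- the limit is a derivative of the exponential at 0.
open Filter Topology in
theorem tendsto_mul_one_sub_exp (x : ℝ) :
    Tendsto (fun n : ℕ => ((n : ℂ) + 1) * (1 - Complex.exp (x / ((n : ℂ) + 1) * Complex.I))) atTop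
      (𝓝 (-(x * Complex.I))) := by
  have h1 : HasDerivAt (fun t : ℝ => Complex.exp (t * (x * Complex.I))) (x * Complex.I) 0 := by
    have := (((hasDerivAt_id (0 : ℂ)).mul_const (x * Complex.I)).cexp).comp_ofReal (z := 0)
    simpa using this
  have h2 : Tendsto (fun n : ℕ => (1 : ℝ) / (n + 1)) atTop (𝓝[≠] 0) :=
    tendsto_nhdsWithin_iff.2 ⟨tendsto_one_div_add_atTop_nhds_zero_nat,
      .of_forall fun n => (Nat.one_div_pos_of_nat (α := ℝ)).ne'⟩
  refine ((hasDerivAt_iff_tendsto_slope_zero.1 h1).comp h2).neg.congr fun n => ?_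
  simp only [Function.comp_apply, zero_add, Complex.real_smul]
  push_cast
  rw [zero_mul, Complex.exp_zero, one_div, inv_inv]
  rw [show ((n : ℂ) + 1)⁻¹ * (x * Complex.I) = x / ((n : ℂ) + 1) * Complex.I by ring]
  ring

open Filter Topology in
/-- The boundary-parallel restrictions of a holomorphic function on the right half-plane that is
completely monotonic on the positive half-line are limits of characteristic functions. -/
theorem exists_tendsto_charFun_of_completelyMonotonicOn {F : ℂ → ℂ} {g : ℝ → ℝ}
    (hF : DifferentiableOn ℂ F {w | 0 < w.re}) (hg : CompletelyMonotonicOn g (Ioi 0))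
    (hFg : ∀ y : ℝ, 0 < y → F y = g y) {δ : ℝ} (hδ : 0 < δ) :
    ∃ μ : ℕ → Measure ℝ, (∀ n, IsFiniteMeasure (μ n)) ∧
      ∀ x : ℝ, Tendsto (fun n => charFun (μ n) x) atTop (𝓝 (F (δ - x * Complex.I))) := by
  have hopen : IsOpen {w : ℂ | 0 < w.re} := isOpen_lt continuous_const Complex.continuous_re
  -- Taylor coefficients at the centre `δ + (n + 1)`, scaled by the circle radius `n + 1`; the sign
  -- `(-1) ^ k` comes from the displacement `-(n + 1) e^{ix/(n+1)}`.
  let a : ℕ → ℕ → ℝ := fun n k => (k.factorial : ℝ)⁻¹ * ((n : ℝ) + 1) ^ k *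
    ((-1) ^ k * iteratedDerivWithin k g (Ioi 0) (δ + (n + 1)))
  have hc : ∀ n : ℕ, 0 < δ + ((n : ℝ) + 1) := fun n => by positivity
  have ha : ∀ n k, 0 ≤ a n k := fun n k => by
    have := hg.2 k (δ + (n + 1)) (hc n)
    positivity
  have hsum : ∀ (n : ℕ) (x : ℝ), HasSum (fun k : ℕ => (a n k : ℂ) *
      Complex.exp (x * ((k : ℝ) / ((n : ℝ) + 1) : ℝ) * Complex.I))
      (F (δ + ((n : ℂ) + 1) * (1 - Complex.exp (x / ((n : ℂ) + 1) * Complex.I)))) := by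
    intro n x
    -- The disc of holomorphy has radius larger by `δ` than the circle, so the series converges on
    -- the whole circle.
    have hball : DifferentiableOn ℂ F
        (Metric.ball ((δ + ((n : ℝ) + 1) : ℝ) : ℂ) (δ + ((n : ℝ) + 1))) := by
      refine hF.mono fun w hw => ?_
      rw [Metric.mem_ball, dist_eq_norm] at hw
      have h1 := (abs_le.1 (Complex.abs_re_le_norm (w - ((δ + ((n : ℝ) + 1) : ℝ) : ℂ)))).1
      rw [Complex.sub_re, Complex.ofReal_re] at h1
      show 0 < w.re
      linarith
    have hnorm : ‖Complex.exp (x / ((n : ℂ) + 1) * Complex.I)‖ = 1 := by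
      have := Complex.norm_exp_ofReal_mul_I (x / ((n : ℝ) + 1))
      push_cast at this
      exact this
    have hn : ‖(n : ℂ) + 1‖ = (n : ℝ) + 1 := by
      rw [← Nat.cast_add_one, Complex.norm_natCast, Nat.cast_add_one]
    have hdiff : (δ + ((n : ℂ) + 1) * (1 - Complex.exp (x / ((n : ℂ) + 1) * Complex.I))) -
        ((δ + ((n : ℝ) + 1) : ℝ) : ℂ) =
        -(((n : ℂ) + 1) * Complex.exp (x / ((n : ℂ) + 1) * Complex.I)) := by
      push_cast
      ring
    have hmem : (δ + ((n : ℂ) + 1) * (1 - Complex.exp (x / ((n : ℂ) + 1) * Complex.I))) ∈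
        Metric.ball ((δ + ((n : ℝ) + 1) : ℝ) : ℂ) (δ + ((n : ℝ) + 1)) := by
      rw [Metric.mem_ball, dist_eq_norm, hdiff, norm_neg, norm_mul, hnorm, hn]
      linarith
    have h := Complex.hasSum_taylorSeries_on_ball hball hmem
    refine h.congr_fun fun k => ?_
    rw [hdiff, iteratedDeriv_ofReal_eq hF hg.1 hFg k (hc n)]
    have hexp : Complex.exp (x * ((k : ℝ) / ((n : ℝ) + 1) : ℝ) * Complex.I) =
        Complex.exp (x / ((n : ℂ) + 1) * Complex.I) ^ k := by
      rw [← Complex.exp_nat_mul]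
      congr 1
      push_cast
      ring
    rw [hexp, neg_pow, mul_pow]
    simp only [a, smul_eq_mul]
    push_cast
    ring
  have hsummable : ∀ n, Summable (a n) := fun n => by
    have := (hsum n 0).summable
    simp only [Complex.ofReal_zero, zero_mul, Complex.exp_zero, mul_one] at this
    exact Complex.summable_ofReal.1 this
  choose μ hμ hchar using fun n : ℕ => exists_charFun_eq_of_hasSum (ha n) (hsummable n)
    (fun k => (k : ℝ) / ((n : ℝ) + 1))
  refine ⟨μ, hμ, fun x => ?_⟩
  have hlim : Tendsto (fun n : ℕ => (δ : ℂ) +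
      ((n : ℂ) + 1) * (1 - Complex.exp (x / ((n : ℂ) + 1) * Complex.I))) atTop
      (𝓝 (δ - x * Complex.I)) := by
    rw [sub_eq_add_neg]
    exact (tendsto_mul_one_sub_exp x).const_add _
  have hcont : ContinuousAt F (δ - x * Complex.I) :=
    (hF.differentiableAt (hopen.mem_nhds (by simpa using hδ))).continuousAt
  refine (hcont.tendsto.comp hlim).congr fun n => ?_
  exact (hsum n x).unique (hchar n x)

theorem completelyMonotonicOn_comp_neg {g : ℝ → ℝ} (hg : AbsolutelyMonotoneOn g (Iio 0)) :
    CompletelyMonotonicOn (fun y => g (-y)) (Ioi 0) := by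
  have hg' := (AbsolutelyMonotoneOn.iff_iteratedDerivWithin_nonneg isOpen_Iio.uniqueDiffOn).1 hg
  refine ⟨hg'.1.comp contDiff_neg.contDiffOn fun y hy => by simpa using hy, fun n y hy => ?_⟩
  have h := hg'.2 n (-y) (by simpa using hy)
  rw [iteratedDerivWithin_of_isOpen isOpen_Iio (by simpa using hy)] at h
  rw [iteratedDerivWithin_of_isOpen isOpen_Ioi hy, iteratedDeriv_comp_neg, smul_eq_mul,
    ← mul_assoc, ← mul_pow]
  simpa using h

/-! ### Poisson integrals and boundary values. -/

/-- The difference of the two Cauchy kernels is twice the Poisson kernel; substitute `t = x + δu`.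
-/
theorem cauchyTransform_sub_cauchyTransform_conj {f : ℝ → ℂ} (hf : Continuous f)
    (hint : Integrable fun t : ℝ => ‖f t‖ / (1 + |t|)) (x : ℝ) {δ : ℝ} (hδ : 0 < δ) :
    cauchyTransform f (x + δ * Complex.I) - cauchyTransform f (x - δ * Complex.I) =
      2 / Real.pi * ∫ u : ℝ, f (x + δ * u) * (((1 + u ^ 2)⁻¹ : ℝ) : ℂ) := by
  have h1 : (x + δ * Complex.I : ℂ).im ≠ 0 := by simpa using hδ.ne'
  have h2 : (x - δ * Complex.I : ℂ).im ≠ 0 := by simpa using hδ.ne'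
  rw [cauchyTransform, cauchyTransform, ← mul_sub, ← integral_sub
    (integrable_div_sub_ofReal hf hint h1) (integrable_div_sub_ofReal hf hint h2)]
  have h3 := Measure.integral_comp_mul_left (fun t : ℝ =>
    f (x + t) / (x + δ * Complex.I - (x + t : ℝ)) - f (x + t) / (x - δ * Complex.I - (x + t : ℝ))) δ
  rw [integral_add_left_eq_self (fun t : ℝ => f t / (x + δ * Complex.I - t) -
    f t / (x - δ * Complex.I - t)) x, abs_of_pos (inv_pos.2 hδ), Complex.real_smul] at h3
  have hδ' : (δ : ℂ) ≠ 0 := by exact_mod_cast hδ.ne'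
  rw [Complex.ofReal_inv, eq_inv_mul_iff_mul_eq₀ hδ'] at h3
  rw [← h3, ← integral_const_mul, ← integral_const_mul, ← integral_const_mul]
  congr 1 with u
  have h4 := sub_ofReal_ne_zero h1 (x + δ * u)
  have h5 := sub_ofReal_ne_zero h2 (x + δ * u)
  have h6 : (1 + (u : ℂ) ^ 2) ≠ 0 := by
    have : (1 + u ^ 2 : ℝ) ≠ 0 := by positivity
    exact_mod_cast this
  have h7 : (x + δ * Complex.I - (x + δ * u : ℝ) : ℂ) * (x - δ * Complex.I - (x + δ * u : ℝ)) =
      δ ^ 2 * (1 + (u : ℂ) ^ 2) := by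
    push_cast
    linear_combination (-(δ : ℂ) ^ 2) * Complex.I_sq
  rw [div_sub_div _ _ h4 h5, h7]
  push_cast
  have hpi : (Real.pi : ℂ) ≠ 0 := by exact_mod_cast Real.pi_ne_zero
  field_simp
  linear_combination (-2 * f (x + δ * u) * δ) * Complex.I_sq

open Filter Topology in
theorem tendsto_cauchyTransform_sub_cauchyTransform_conj {f : ℝ → ℂ} (hf : Continuous f)
    (hb : ∃ C : ℝ, ∀ t : ℝ, ‖f t‖ ≤ C) (hint : Integrable fun t : ℝ => ‖f t‖ / (1 + |t|))
    (x : ℝ) {δ : ℕ → ℝ} (hδ : ∀ n, 0 < δ n) (hδ0 : Tendsto δ atTop (𝓝 0)) :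
    Tendsto (fun n => cauchyTransform f (x + δ n * Complex.I) -
      cauchyTransform f (x - δ n * Complex.I)) atTop (𝓝 (2 * f x)) := by
  obtain ⟨C, hC⟩ := hb
  have h1 : Tendsto (fun n => ∫ u : ℝ, f (x + δ n * u) * (((1 + u ^ 2)⁻¹ : ℝ) : ℂ)) atTop
      (𝓝 (∫ u : ℝ, f x * (((1 + u ^ 2)⁻¹ : ℝ) : ℂ))) := by
    have hcont : Continuous fun u : ℝ => (((1 + u ^ 2)⁻¹ : ℝ) : ℂ) :=
      Complex.continuous_ofReal.comp ((by fun_prop : Continuous fun u : ℝ => 1 + u ^ 2).inv₀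
        fun u => by positivity)
    refine tendsto_integral_of_dominated_convergence (fun u => C * (1 + u ^ 2)⁻¹)
      (fun n => (Continuous.mul (by fun_prop) hcont).aestronglyMeasurable)
      (integrable_inv_one_add_sq.const_mul C)
      (fun n => .of_forall fun u => ?_) (.of_forall fun u => ?_)
    · rw [norm_mul, Complex.norm_real, Real.norm_of_nonneg (by positivity)]
      exact mul_le_mul_of_nonneg_right (hC _) (by positivity)
    · refine Tendsto.mul_const _ ((hf.tendsto x).comp ?_)
      simpa using (hδ0.mul_const u).const_add x
  rw [integral_const_mul, integral_complex_ofReal, integral_univ_inv_one_add_sq] at h1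
  have h2 := h1.const_mul (2 / Real.pi : ℂ)
  have hpi : (Real.pi : ℂ) ≠ 0 := by exact_mod_cast Real.pi_ne_zero
  rw [show (2 / Real.pi : ℂ) * (f x * Real.pi) = 2 * f x by field_simp] at h2
  exact h2.congr fun n => (cauchyTransform_sub_cauchyTransform_conj hf hint x (hδ n)).symm

theorem differentiableOn_cauchyTransform_I_mul {f : ℝ → ℂ} (hf : Continuous f)
    (hint : Integrable fun t : ℝ => ‖f t‖ / (1 + |t|)) :
    DifferentiableOn ℂ (fun w => cauchyTransform f (Complex.I * w)) {w | 0 < w.re} := by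
  intro w hw
  refine (DifferentiableAt.comp w (differentiableAt_cauchyTransform hf hint ?_)
    (by fun_prop)).differentiableWithinAt
  simpa using hw.ne'

/-! ### Sufficiency of the monotonicity conditions. -/

theorem charFun_add_map_neg (μ ν : Measure ℝ) [IsFiniteMeasure μ] [IsFiniteMeasure ν] (x : ℝ) :
    charFun (μ + ν.map fun s => -1 * s) x = charFun μ x + charFun ν (-x) := by
  have hint : ∀ (ρ : Measure ℝ) [IsFiniteMeasure ρ],
      Integrable (fun s : ℝ => Complex.exp (inner ℝ s x * Complex.I)) ρ := fun ρ _ => by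
    refine (integrable_const (1 : ℝ)).mono' (by fun_prop) (.of_forall fun s => ?_)
    rw [Complex.norm_exp_ofReal_mul_I]
  rw [charFun_apply, integral_add_measure (hint _) (hint _), ← charFun_apply, ← charFun_apply,
    charFun_map_mul, neg_one_mul]

open Filter Topology in
theorem isCharacteristicFunction_of_completelyMonotonicOn {f : ℝ → ℂ} (hf : Continuous f)
    (hb : ∃ C : ℝ, ∀ t : ℝ, ‖f t‖ ≤ C) (h0 : f 0 = 1)
    (hint : Integrable fun t : ℝ => ‖f t‖ / (1 + |t|)) {g₁ g₂ : ℝ → ℝ}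
    (hg₁ : CompletelyMonotonicOn g₁ (Ioi 0))
    (hk₁ : ∀ y : ℝ, 0 < y → cauchyTransform f (Complex.I * (y : ℂ)) = (g₁ y : ℂ))
    (hg₂ : AbsolutelyMonotoneOn g₂ (Iio 0))
    (hk₂ : ∀ y : ℝ, y < 0 → -cauchyTransform f (Complex.I * (y : ℂ)) = (g₂ y : ℂ)) :
    IsCharacteristicFunction f := by
  have hstep : ∀ δ : ℝ, 0 < δ → ∃ σ : Measure ℝ, IsFiniteMeasure σ ∧ ∀ x : ℝ, charFun σ x =
      cauchyTransform f (x + δ * Complex.I) - cauchyTransform f (x - δ * Complex.I) := by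
    intro δ hδ
    obtain ⟨μ, hμ, hμx⟩ := exists_tendsto_charFun_of_completelyMonotonicOn
      (differentiableOn_cauchyTransform_I_mul hf hint) hg₁ hk₁ hδ
    obtain ⟨ν, hν, hνx⟩ := exists_tendsto_charFun_of_completelyMonotonicOn
      (differentiableOn_cauchyTransform_I_mul (f := fun t => f (-t)) (hf.comp continuous_neg)
        (integrable_norm_div_comp_neg hint)) (completelyMonotonicOn_comp_neg hg₂)
      (fun y hy => by
        rw [cauchyTransform_comp_neg, ← hk₂ (-y) (neg_lt_zero.2 hy)]
        push_cast
        rw [mul_neg]) hδ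
    have hfin : ∀ n, IsFiniteMeasure (μ n + (ν n).map fun s => -1 * s) := fun n => inferInstance
    refine exists_charFun_eq_of_tendsto (μ := fun n => μ n + (ν n).map fun s => -1 * s)
      ?_ fun x => ?_
    · refine ContinuousAt.sub ?_ ?_
      · refine ContinuousAt.comp (f := fun x : ℝ => (x + δ * Complex.I : ℂ))
          (differentiableAt_cauchyTransform hf hint ?_).continuousAt
          (by fun_prop)
        simpa using hδ.ne'
      · refine ContinuousAt.comp (f := fun x : ℝ => (x - δ * Complex.I : ℂ))
          (differentiableAt_cauchyTransform hf hint ?_).continuousAt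
          (by fun_prop)
        simpa using hδ.ne'
    -- For `w = δ - ix`, `iw = x + iδ`. The reflected function at `-x` has `iw = -x + iδ`, and its
    -- transform there is `-k_f(x - iδ)`.
    · have h := (hμx x).add (hνx (-x))
      simp_rw [charFun_add_map_neg]
      convert h using 2
      rw [cauchyTransform_comp_neg, ← sub_eq_add_neg]
      congr 2
      · linear_combination (x : ℂ) * Complex.I_sq
      · push_cast
        linear_combination (x : ℂ) * Complex.I_sq
  choose σ hσ hσx using fun n : ℕ => hstep (1 / ((n : ℝ) + 1)) Nat.one_div_pos_of_nat
  obtain ⟨ρ, hρ, hρx⟩ := exists_charFun_eq_of_tendsto (μ := σ) (φ := fun x => 2 * f x)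
    (by fun_prop) fun x => by
      simp_rw [hσx]
      exact tendsto_cauchyTransform_sub_cauchyTransform_conj hf hb hint x
        (fun n => Nat.one_div_pos_of_nat) tendsto_one_div_add_atTop_nhds_zero_nat
  -- The limit measure has mass `2 f(0) = 2`.
  refine ⟨(2⁻¹ : NNReal) • ρ, ⟨?_⟩, fun x => ?_⟩
  · have h := hρx 0
    rw [charFun_zero, h0, mul_one] at h
    have h' : ρ.real univ = 2 := by exact_mod_cast h
    have h2 : ρ univ = 2 := by
      rw [← ENNReal.ofReal_toReal (measure_ne_top ρ univ)]
      change ENNReal.ofReal (ρ.real univ) = 2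
      rw [h']
      simp
    rw [Measure.smul_apply, h2, ENNReal.smul_def, smul_eq_mul, ENNReal.coe_inv two_ne_zero]
    exact ENNReal.inv_mul_cancel two_ne_zero ENNReal.ofNat_ne_top
  · have h := hρx x
    rw [charFun_apply] at h ⊢
    rw [integral_smul_nnreal_measure, h, NNReal.smul_def, Complex.real_smul]
    push_cast
    ring

/-! ### Necessity: Fourier inversion and Laplace transforms. -/

/-- A single one-sided exponential jumps at 0, which blocks Fourier inversion; in the difference the
jumps cancel, and its transform decays like `1 / t ^ 2`. -/
theorem continuous_exp_max_sub_exp_max (y Y : ℝ) : Continuous fun s : ℝ =>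
    ((Real.exp (-y * max s 0) - Real.exp (-Y * max s 0) : ℝ) : ℂ) := by
  fun_prop

theorem exp_max_sub_exp_max_eq_indicator (y Y s : ℝ) :
    ((Real.exp (-y * max s 0) - Real.exp (-Y * max s 0) : ℝ) : ℂ) =
      (Ioi (0 : ℝ)).indicator (fun s : ℝ => Complex.exp (-y * s) - Complex.exp (-Y * s)) s := by
  rcases le_or_gt s 0 with hs | hs
  · rw [indicator_of_notMem (by simpa using hs), max_eq_right hs]
    simp
  · rw [indicator_of_mem (by simpa using hs), max_eq_left hs.le]
    push_cast
    rfl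

theorem integrable_exp_max_sub_exp_max {y Y : ℝ} (hy : 0 < y) (hY : 0 < Y) :
    Integrable fun s : ℝ => ((Real.exp (-y * max s 0) - Real.exp (-Y * max s 0) : ℝ) : ℂ) := by
  simp_rw [exp_max_sub_exp_max_eq_indicator]
  rw [integrable_indicator_iff measurableSet_Ioi]
  exact (integrableOn_exp_mul_complex_Ioi (by simpa using hy) 0).sub
    (integrableOn_exp_mul_complex_Ioi (by simpa using hY) 0)

theorem fourier_exp_max_sub_exp_max {y Y : ℝ} (hy : 0 < y) (hY : 0 < Y) (w : ℝ) :
    FourierTransform.fourier (fun s : ℝ =>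
      ((Real.exp (-y * max s 0) - Real.exp (-Y * max s 0) : ℝ) : ℂ)) w =
      Complex.I / (Complex.I * y - (2 * Real.pi * w : ℝ)) -
        Complex.I / (Complex.I * Y - (2 * Real.pi * w : ℝ)) := by
  have key : ∀ {a : ℝ}, 0 < a →
      -Complex.exp ((-a - 2 * Real.pi * w * Complex.I) * (0 : ℝ)) /
        (-a - 2 * Real.pi * w * Complex.I) =
      Complex.I / (Complex.I * a - (2 * Real.pi * w : ℝ)) := by
    intro a ha
    have h1 : (Complex.I * a - (2 * Real.pi * w : ℝ) : ℂ) ≠ 0 :=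
      sub_ofReal_ne_zero (by simpa using ha.ne') _
    have h2 : (Complex.I * a - (2 * Real.pi * w : ℝ) : ℂ) =
        -Complex.I * (-a - 2 * Real.pi * w * Complex.I) := by
      push_cast
      linear_combination (-2 * Real.pi * w : ℂ) * Complex.I_sq
    have h3 : (-a - 2 * Real.pi * w * Complex.I : ℂ) ≠ 0 := by
      intro h
      rw [h2, h, mul_zero] at h1
      exact h1 rfl
    rw [h2, Complex.ofReal_zero, mul_zero, Complex.exp_zero]
    field_simp
  have hre : ∀ {a : ℝ}, 0 < a → (-a - 2 * Real.pi * w * Complex.I : ℂ).re < 0 := by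
    intro a ha
    simpa using ha
  rw [Real.fourier_real_eq_integral_exp_smul, ← key hy, ← key hY,
    ← integral_exp_mul_complex_Ioi (hre hy), ← integral_exp_mul_complex_Ioi (hre hY),
    ← integral_sub (integrableOn_exp_mul_complex_Ioi (hre hy) 0)
      (integrableOn_exp_mul_complex_Ioi (hre hY) 0), ← integral_indicator measurableSet_Ioi]
  congr 1 with s
  rw [exp_max_sub_exp_max_eq_indicator, smul_eq_mul]
  by_cases hs : s ∈ Ioi (0 : ℝ)
  · rw [indicator_of_mem hs, indicator_of_mem hs, mul_sub, ← Complex.exp_add, ← Complex.exp_add]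
    congr 2 <;> · push_cast; ring
  · rw [indicator_of_notMem hs, indicator_of_notMem hs, mul_zero]

theorem integrable_I_div_sub_I_div {y Y : ℝ} (hy : 0 < y) (hY : 0 < Y) :
    Integrable fun t : ℝ => Complex.I / (Complex.I * y - t) - Complex.I / (Complex.I * Y - t) := by
  have him : ∀ {a : ℝ}, 0 < a → (Complex.I * a : ℂ).im ≠ 0 := fun ha => by simpa using ha.ne'
  have hc : ∀ {a : ℝ}, 0 < a → 0 ≤ (1 + ‖(Complex.I * a : ℂ)‖) / |(Complex.I * a : ℂ).im| + 1 :=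
    fun ha => by positivity
  set C₁ := (1 + ‖(Complex.I * y : ℂ)‖) / |(Complex.I * y : ℂ).im| + 1
  set C₂ := (1 + ‖(Complex.I * Y : ℂ)‖) / |(Complex.I * Y : ℂ).im| + 1
  refine (integrable_inv_one_add_sq.const_mul (|Y - y| * (C₁ * C₂))).mono'
    ((continuous_div_sub_ofReal continuous_const (him hy)).sub
      (continuous_div_sub_ofReal continuous_const (him hY))).aestronglyMeasurable
    (.of_forall fun t => ?_)
  have h1 := inv_norm_sub_le (abs_pos.2 (him hy)) le_rfl le_rfl t
  have h2 := inv_norm_sub_le (abs_pos.2 (him hY)) le_rfl le_rfl t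
  have h3 : Complex.I / (Complex.I * y - t) - Complex.I / (Complex.I * Y - t) =
      ((y - Y : ℝ) : ℂ) * ((Complex.I * y - t)⁻¹ * (Complex.I * Y - t)⁻¹) := by
    have h4 := sub_ofReal_ne_zero (him hy) t
    have h5 := sub_ofReal_ne_zero (him hY) t
    field_simp
    push_cast
    linear_combination (Y - y : ℂ) * Complex.I_sq
  rw [h3, norm_mul, norm_mul, norm_inv, norm_inv, Complex.norm_real, Real.norm_eq_abs,
    abs_sub_comm, mul_assoc]
  refine mul_le_mul_of_nonneg_left ?_ (abs_nonneg _)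
  calc _ ≤ C₁ / (1 + |t|) * (C₂ / (1 + |t|)) :=
        mul_le_mul h1 h2 (by positivity) (div_nonneg (hc hy) (by positivity))
    _ = C₁ * C₂ * ((1 + |t|) ^ 2)⁻¹ := by rw [div_mul_div_comm, ← sq, div_eq_mul_inv]
    _ ≤ C₁ * C₂ * (1 + t ^ 2)⁻¹ := by
      refine mul_le_mul_of_nonneg_left (inv_anti₀ (by positivity) ?_) (mul_nonneg (hc hy) (hc hY))
      nlinarith [abs_nonneg t, sq_abs t]

theorem integral_exp_mul_I_div_sub_I_div {y Y : ℝ} (hy : 0 < y) (hY : 0 < Y) (s : ℝ) :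
    ∫ t : ℝ, Complex.exp (s * t * Complex.I) *
        (Complex.I / (Complex.I * y - t) - Complex.I / (Complex.I * Y - t)) =
      2 * Real.pi * ((Real.exp (-y * max s 0) - Real.exp (-Y * max s 0) : ℝ) : ℂ) := by
  have h2pi : (2 * Real.pi : ℝ) ≠ 0 := by positivity
  have hfour := funext (fourier_exp_max_sub_exp_max hy hY)
  have hinv := congrFun (Continuous.fourierInv_fourier_eq (continuous_exp_max_sub_exp_max y Y)
    (integrable_exp_max_sub_exp_max hy hY) (by
      rw [hfour]
      exact (integrable_I_div_sub_I_div hy hY).comp_mul_left' h2pi)) s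
  rw [hfour, Real.fourierInv_eq'] at hinv
  have hcomp := Measure.integral_comp_mul_left (fun t : ℝ => Complex.exp (s * t * Complex.I) *
    (Complex.I / (Complex.I * y - t) - Complex.I / (Complex.I * Y - t))) (2 * Real.pi)
  rw [abs_of_pos (by positivity), Complex.real_smul] at hcomp
  rw [← hinv]
  have hcongr : ∀ v : ℝ, Complex.exp (s * (2 * Real.pi * v : ℝ) * Complex.I) =
      Complex.exp ((2 * Real.pi * inner ℝ v s : ℝ) * Complex.I) := fun v => by
    congr 1
    simp only [RCLike.inner_apply, conj_trivial]
    push_cast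
    ring
  simp_rw [hcongr] at hcomp
  simp_rw [smul_eq_mul]
  rw [hcomp, ← mul_assoc]
  have : (2 * Real.pi : ℂ) * (((2 * Real.pi)⁻¹ : ℝ) : ℂ) = 1 := by
    push_cast
    exact mul_inv_cancel₀ (by exact_mod_cast h2pi)
  rw [this, one_mul]

/-- Fubini applies because the difference of two Cauchy kernels is integrable in `t`; a single
kernel is not. -/
theorem cauchyTransform_charFun_sub {σ : Measure ℝ} [IsFiniteMeasure σ]
    (hint : Integrable fun t : ℝ => ‖charFun σ t‖ / (1 + |t|)) {y Y : ℝ} (hy : 0 < y)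
    (hY : 0 < Y) :
    cauchyTransform (charFun σ) (Complex.I * y) - cauchyTransform (charFun σ) (Complex.I * Y) =
      2 * ∫ s, ((Real.exp (-y * max s 0) - Real.exp (-Y * max s 0) : ℝ) : ℂ) ∂σ := by
  have hf : Continuous (charFun σ) := by fun_prop
  rw [cauchyTransform, cauchyTransform, ← mul_sub, ← integral_sub
    (integrable_div_sub_ofReal hf hint (by simpa using hy.ne'))
    (integrable_div_sub_ofReal hf hint (by simpa using hY.ne'))]
  have h1 : ∀ t : ℝ, charFun σ t / (Complex.I * y - t) - charFun σ t / (Complex.I * Y - t) =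
      -Complex.I * ∫ s, Complex.exp (s * t * Complex.I) *
        (Complex.I / (Complex.I * y - t) - Complex.I / (Complex.I * Y - t)) ∂σ := by
    intro t
    rw [integral_mul_const, charFun_apply_real]
    simp_rw [mul_comm (t : ℂ)]
    linear_combination ((∫ s, Complex.exp (s * t * Complex.I) ∂σ) *
      (1 / (Complex.I * y - t) - 1 / (Complex.I * Y - t))) * Complex.I_sq
  have hprod : Integrable (Function.uncurry fun (t s : ℝ) => Complex.exp (s * t * Complex.I) *
      (Complex.I / (Complex.I * y - t) - Complex.I / (Complex.I * Y - t))) (volume.prod σ) := by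
    have := (integrable_I_div_sub_I_div hy hY).mul_prod (ν := σ) (integrable_const (1 : ℂ))
    simp only [mul_one] at this
    refine this.norm.mono' (AEStronglyMeasurable.mul (Continuous.aestronglyMeasurable
      (by fun_prop)) this.aestronglyMeasurable) (.of_forall fun p => ?_)
    simp only [Function.uncurry]
    rw [norm_mul, ← Complex.ofReal_mul,
      Complex.norm_exp_ofReal_mul_I, one_mul]
  simp_rw [h1]
  rw [integral_const_mul, integral_integral_swap hprod]
  simp_rw [integral_exp_mul_I_div_sub_I_div hy hY]
  rw [integral_const_mul]
  have hpi : (Real.pi : ℂ) ≠ 0 := by exact_mod_cast Real.pi_ne_zero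
  generalize (∫ s, ((Real.exp (-y * max s 0) - Real.exp (-Y * max s 0) : ℝ) : ℂ) ∂σ) = A
  field_simp
  linear_combination -A * Complex.I_sq

open Filter Topology in
theorem tendsto_cauchyTransform_I_mul_atTop {f : ℝ → ℂ} (hf : Continuous f)
    (hint : Integrable fun t : ℝ => ‖f t‖ / (1 + |t|)) :
    Tendsto (fun n : ℕ => cauchyTransform f (Complex.I * ((n + 1 : ℝ) : ℂ))) atTop (𝓝 0) := by
  have hpos : ∀ n : ℕ, (0 : ℝ) < n + 1 := fun n => by positivity
  have h : Tendsto (fun n : ℕ => ∫ t : ℝ, f t / (Complex.I * ((n + 1 : ℝ) : ℂ) - t)) atTop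
      (𝓝 (∫ _ : ℝ, 0)) := by
    -- The factor 2 works for all `n`: `‖i(n + 1) - t‖` is at least 1 and at least `|t|`, hence at
    -- least `(1 + |t|) / 2`.
    refine tendsto_integral_of_dominated_convergence (fun t => 2 * (‖f t‖ / (1 + |t|)))
      (fun n => (continuous_div_sub_ofReal hf
        (by simpa using (hpos n).ne')).aestronglyMeasurable) (hint.const_mul 2)
      (fun n => .of_forall fun t => ?_) (.of_forall fun t => ?_)
    · rw [norm_div, div_eq_mul_inv, div_eq_mul_inv, mul_left_comm, ← div_eq_mul_inv]
      refine mul_le_mul_of_nonneg_left ?_ (norm_nonneg _)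
      have him : (n + 1 : ℝ) ≤ ‖Complex.I * ((n + 1 : ℝ) : ℂ) - t‖ := by
        have := Complex.abs_im_le_norm (Complex.I * ((n + 1 : ℝ) : ℂ) - t)
        simp only [Complex.sub_im, Complex.mul_im, Complex.I_re, Complex.I_im, Complex.ofReal_im,
          Complex.ofReal_re, zero_mul, one_mul, zero_add, sub_zero] at this
        exact (le_abs_self _).trans this
      have hre : |t| ≤ ‖Complex.I * ((n + 1 : ℝ) : ℂ) - t‖ := by
        have := Complex.abs_re_le_norm (Complex.I * ((n + 1 : ℝ) : ℂ) - t)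
        simpa using this
      have hn : (0 : ℝ) ≤ n := n.cast_nonneg
      rw [← div_eq_mul_inv, inv_le_comm₀ (by linarith [hpos n]) (by positivity), inv_div,
        div_le_iff₀ two_pos]
      linarith
    · have h1 : Tendsto (fun n : ℕ => ‖Complex.I * ((n + 1 : ℝ) : ℂ) - t‖) atTop atTop := by
        refine tendsto_atTop_mono (fun n : ℕ => ?_) tendsto_natCast_atTop_atTop
        have := Complex.abs_im_le_norm (Complex.I * ((n + 1 : ℝ) : ℂ) - t)
        simp only [Complex.sub_im, Complex.mul_im, Complex.I_re, Complex.I_im, Complex.ofReal_im,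
          Complex.ofReal_re, zero_mul, one_mul, zero_add, sub_zero] at this
        linarith [le_abs_self ((n : ℝ) + 1)]
      rw [tendsto_zero_iff_norm_tendsto_zero]
      simp_rw [norm_div]
      exact tendsto_const_nhds.div_atTop h1
  rw [integral_zero] at h
  simpa only [cauchyTransform, mul_zero] using h.const_mul (Complex.I / Real.pi)

open Filter Topology ProbabilityTheory in
/-- On the positive imaginary axis the Cauchy transform of a characteristic function is a Laplace
transform. -/
theorem cauchyTransform_charFun_I_mul {σ : Measure ℝ} [IsFiniteMeasure σ]
    (hint : Integrable fun t : ℝ => ‖charFun σ t‖ / (1 + |t|)) {y : ℝ} (hy : 0 < y) :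
    cauchyTransform (charFun σ) (Complex.I * y) =
      ((2 * mgf id (σ.restrict (Ioi 0)) (-y) : ℝ) : ℂ) := by
  have hf : Continuous (charFun σ) := by fun_prop
  have h1 := (tendsto_cauchyTransform_I_mul_atTop hf hint).const_sub
    (cauchyTransform (charFun σ) (Complex.I * y))
  rw [sub_zero] at h1
  -- At `s ≤ 0` both exponentials equal 1, so the limit lives on the open half-line and an atom at 0
  -- would not contribute.
  have h2 : Tendsto (fun n : ℕ =>
      ∫ s, (Real.exp (-y * max s 0) - Real.exp (-(n + 1 : ℝ) * max s 0)) ∂σ) atTop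
      (𝓝 (∫ s, (Ioi (0 : ℝ)).indicator (fun s => Real.exp (-y * s)) s ∂σ)) := by
    refine tendsto_integral_of_dominated_convergence (fun _ => 1)
      (fun n => Continuous.aestronglyMeasurable (by fun_prop)) (integrable_const 1)
      (fun n => .of_forall fun s => ?_) (.of_forall fun s => ?_)
    · have hs : 0 ≤ max s 0 := le_max_right _ _
      have e1 : Real.exp (-y * max s 0) ≤ 1 := Real.exp_le_one_iff.2 (by nlinarith)
      have e2 : Real.exp (-(n + 1 : ℝ) * max s 0) ≤ 1 := Real.exp_le_one_iff.2 (by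
        have : (0 : ℝ) ≤ (n + 1) * max s 0 := by positivity
        linarith)
      rw [Real.norm_eq_abs, abs_le]
      constructor <;> linarith [Real.exp_pos (-y * max s 0), Real.exp_pos (-(n + 1 : ℝ) * max s 0)]
    · rcases le_or_gt s 0 with hs | hs
      · rw [indicator_of_notMem (by simpa using hs), max_eq_right hs]
        simp
      · rw [indicator_of_mem (by simpa using hs), max_eq_left hs.le]
        have h3 : Tendsto (fun n : ℕ => -(n + 1 : ℝ) * s) atTop atBot := by
          simp_rw [neg_mul]
          exact tendsto_neg_atTop_atBot.comp ((tendsto_natCast_atTop_atTop.atTop_add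
            tendsto_const_nhds).atTop_mul_const hs)
        simpa using (Real.tendsto_exp_atBot.comp h3).const_sub (Real.exp (-y * s))
  have h3 := ((Complex.continuous_ofReal.tendsto _).comp h2).const_mul 2
  rw [integral_indicator measurableSet_Ioi] at h3
  refine (tendsto_nhds_unique h1 (h3.congr fun n => ?_)).trans ?_
  · rw [cauchyTransform_charFun_sub hint hy (by positivity), integral_complex_ofReal]
    rfl
  · push_cast
    rfl

-- Differentiating under the integral produces `s ^ n e^{ts}`, nonnegative for `s > 0`.
open ProbabilityTheory in
theorem absolutelyMonotoneOn_mgf_restrict_Ioi (σ : Measure ℝ) [IsFiniteMeasure σ] :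
    AbsolutelyMonotoneOn (mgf id (σ.restrict (Ioi 0))) (Iio 0) := by
  have hsub : Iio 0 ⊆ interior (integrableExpSet id (σ.restrict (Ioi 0))) := by
    refine interior_maximal (fun t ht => ?_) isOpen_Iio
    refine (integrable_const (1 : ℝ)).mono' (Continuous.aestronglyMeasurable (by
      simp only [id]; fun_prop)) ?_
    filter_upwards [ae_restrict_mem measurableSet_Ioi] with s hs
    rw [Real.norm_eq_abs, Real.abs_exp]
    exact Real.exp_le_one_iff.2 (mul_nonpos_of_nonpos_of_nonneg (le_of_lt ht) (le_of_lt hs))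
  rw [AbsolutelyMonotoneOn.iff_iteratedDerivWithin_nonneg isOpen_Iio.uniqueDiffOn]
  refine ⟨(analyticOn_mgf.mono hsub).contDiffOn isOpen_Iio.uniqueDiffOn, fun n t ht => ?_⟩
  rw [iteratedDerivWithin_of_isOpen isOpen_Iio ht, iteratedDeriv_mgf (hsub ht)]
  refine setIntegral_nonneg measurableSet_Ioi fun s hs => ?_
  exact mul_nonneg (pow_nonneg (le_of_lt hs) n) (Real.exp_pos _).le

theorem theorem3 (f : ℝ → ℂ) (hf : Continuous f) (hb : ∃ C : ℝ, ∀ t : ℝ, ‖f t‖ ≤ C)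
    (h0 : f 0 = 1) (hint : Integrable (fun t : ℝ => ‖f t‖ / (1 + |t|))) :
    IsCharacteristicFunction f ↔
      (∃ g : ℝ → ℝ, CompletelyMonotonicOn g (Ioi 0) ∧
        ∀ y : ℝ, 0 < y → cauchyTransform f (Complex.I * (y : ℂ)) = (g y : ℂ)) ∧
      (∃ g : ℝ → ℝ, AbsolutelyMonotoneOn g (Iio 0) ∧
        ∀ y : ℝ, y < 0 → -cauchyTransform f (Complex.I * (y : ℂ)) = (g y : ℂ)) := by
  constructor
  · rintro ⟨σ, hσ, hσf⟩
    obtain rfl : f = charFun σ := funext hσf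
    refine ⟨⟨_, completelyMonotonicOn_comp_neg
      ((absolutelyMonotoneOn_mgf_restrict_Ioi σ).smul zero_le_two), fun y hy => ?_⟩,
      _, (absolutelyMonotoneOn_mgf_restrict_Ioi (σ.map fun s => -1 * s)).smul zero_le_two,
      fun y hy => ?_⟩
    · exact cauchyTransform_charFun_I_mul hint hy
    -- Reflecting `σ` reflects `f`, which carries the negative imaginary axis to the positive one.
    · have hneg : charFun (σ.map fun s => -1 * s) = fun t => charFun σ (-t) := by
        ext t
        rw [charFun_map_mul, neg_one_mul]
      have h := cauchyTransform_charFun_I_mul (σ := σ.map fun s => -1 * s)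
        (by rw [hneg]; exact integrable_norm_div_comp_neg hint) (neg_pos.2 hy)
      rw [hneg, cauchyTransform_comp_neg, neg_neg, Complex.ofReal_neg, mul_neg, neg_neg] at h
      exact h
  · rintro ⟨⟨g₁, hg₁, hk₁⟩, g₂, hg₂, hk₂⟩
    exact isCharacteristicFunction_of_completelyMonotonicOn hf hb h0 hint hg₁ hk₁ hg₂ hk₂
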